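/- Let $L$ be a meet-semilattice with minimum element in which, for every $p\in L$, the chains with top element $p$ have bounded length; the rank $r(p)\in\mathbb Z_{\ge 0}$ is the maximal length of a chain from the minimum element to $p$. Assume that $L$ is a modular semilattice: every principal ideal $\{x : x\preceq p\}$ is a modular lattice, and $x\vee y\vee z$ exists whenever $x\vee y$, $y\vee z$, $z\vee x$ exist. Let $d(p,q)$ be the shortest-path distance in the Hasse diagram of $L$. Fractional join. Let $M$ be $L\times L$ with the product order (again a modular semilattice, whose rank function is also denoted by $r$). For $p,q\in M$ let $I(p,q)$ be the set of all $u\in M$ of the form $u=a\vee b$ with $p\wedge q\preceq a\preceq p$ and $p\wedge q\preceq b\preceq q$. For $u\in I(p,q)$ put $$r(u;p,q)=\bigl(r(u\wedge p)-r(p\wedge q),\ r(u\wedge q)-r(p\wedge q)\bigr)\in\mathbb R_+^2,$$ let $\operatorname{Conv} I(p,q)$ be the convex hull of these vectors, and let $E(p,q)$ be the set of all $u\in I(p,q)$ for which $r(u;p,q)$ is a maximal extreme point of $\operatorname{Conv} I(p,q)$ in the coordinatewise order. For $u\in E(p,q)$ let $$C(u;p,q)=\Bigl\{c\in\mathbb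 R_+^2 : \langle c,r(u;p,q)\rangle=\max_{x\in\operatorname{Conv} I(p,q)}\langle c,x\rangle\Bigr\}.$$ For a cone $C=\{(x,y)\in\mathbb R_+^2 : y\cos\alpha\le x\sin\alpha,\ y\cos\beta\ge x\sin\beta\}$ with $0\le\beta\le\alpha\le\pi/2$ put $$[C]=\frac{\sin\alpha}{\sin\alpha+\cos\alpha}-\frac{\sin\beta}{\sin\beta+\cos\beta}.$$ The fractional join of $p,q$ is the formal sum $\sum_{u\in E(p,q)}[C(u;p,q)]\,u$, and $f:M\to\mathbb R$ is submodular if $$f(p)+f(q)\ \ge\ f(p\wedge q)+\sum_{u\in E(p,q)}[C(u;p,q)]\,f(u)\qquad(p,q\in M).$$ Theorem. All sets $E(p,q)$ with $p,q\in L\times L$ are finite; the Hasse diagram of $L$ is connected, with $$d(p,q)=r(p)+r(q)-2\,r(p\wedge q)\qquad(p,q\in L);$$ and the distance function $d$ is submodular on $L\times L$. -/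

import Mathlib

namespace FracJoin

/-- A modular semilattice: a meet-semilattice in which every principal ideal is a modular lattice,
and in which `x ∨ y ∨ z` exists as soon as `x ∨ y`, `y ∨ z` and `z ∨ x` exist.
Joins are partial; `IsLUB {x, y} s` says that `x ∨ y` exists and equals `s`. (In a meet-semilattice
a join formed inside a principal ideal is automatically a join in the whole semilattice.) -/
structure IsModularSemilattice (L : Type*) [SemilatticeInf L] : Prop where
  /-- every principal ideal is a lattice -/
  exists_sup_of_le : ∀ p x y : L, x ≤ p → y ≤ p → ∃ s, IsLUB {x, y} s
  /-- in every principal ideal, `x ∧ (y ∨ z) = (x ∧ y) ∨ z` whenever `z ≤ x` -/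
  modular_of_le : ∀ p x y z s : L, x ≤ p → y ≤ p → z ≤ x →
    IsLUB {y, z} s → IsLUB {x ⊓ y, z} (x ⊓ s)
  /-- pairwise joins of three elements yield the triple join -/
  exists_sup_triple : ∀ x y z : L, (∃ s, IsLUB {x, y} s) → (∃ s, IsLUB {y, z} s) →
    (∃ s, IsLUB {z, x} s) → ∃ s, IsLUB {x, y, z} s

/-- The rank `r(p)`: the length of a longest chain from the minimum element to `p`
(in a modular semilattice all maximal chains from the minimum to `p` have this length).
It is meaningful where `Order.height p` is finite. -/
noncomputable def rank {L : Type*} [Preorder L] (p : L) : ℕ := (Order.height p).toNat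

/-- The set `I(p,q)` of all `u = a ∨ b` with `p ∧ q ≤ a ≤ p` and `p ∧ q ≤ b ≤ q`. -/
def joinSet {L : Type*} [SemilatticeInf L] (p q : L) : Set L :=
  {u | ∃ a b, p ⊓ q ≤ a ∧ a ≤ p ∧ p ⊓ q ≤ b ∧ b ≤ q ∧ IsLUB {a, b} u}

/-- The vector `r(u;p,q) = (r(u ∧ p) - r(p ∧ q), r(u ∧ q) - r(p ∧ q))`. -/
noncomputable def rankVec {L : Type*} [SemilatticeInf L] (p q u : L) : ℝ × ℝ :=
  ((rank (u ⊓ p) : ℝ) - rank (p ⊓ q), (rank (u ⊓ q) : ℝ) - rank (p ⊓ q))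

/-- `Conv I(p,q)`: the convex hull of the vectors `r(u;p,q)`, `u ∈ I(p,q)`. -/
noncomputable def hull {L : Type*} [SemilatticeInf L] (p q : L) : Set (ℝ × ℝ) :=
  convexHull ℝ (rankVec p q '' joinSet p q)

/-- The set `E(p,q)` of all `u ∈ I(p,q)` for which `r(u;p,q)` is a maximal extreme point of
`Conv I(p,q)`, in the coordinatewise order of the plane. -/
def extremalSet {L : Type*} [SemilatticeInf L] (p q : L) : Set L :=
  {u | u ∈ joinSet p q ∧ Maximal (fun x => x ∈ (hull p q).extremePoints ℝ) (rankVec p q u)}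

/-- The nonnegative normal cone `C(u;p,q)` of `Conv I(p,q)` at `r(u;p,q)`. -/
def normalCone {L : Type*} [SemilatticeInf L] (p q u : L) : Set (ℝ × ℝ) :=
  {c | 0 ≤ c.1 ∧ 0 ≤ c.2 ∧ ∀ x ∈ hull p q,
    c.1 * x.1 + c.2 * x.2 ≤ c.1 * (rankVec p q u).1 + c.2 * (rankVec p q u).2}

/-- The cone of all vectors of the nonnegative quadrant whose angle is between `β` and `α`. -/
def angularCone (α β : ℝ) : Set (ℝ × ℝ) :=
  {v | 0 ≤ v.1 ∧ 0 ≤ v.2 ∧ v.2 * Real.cos α ≤ v.1 * Real.sin α ∧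
    v.1 * Real.sin β ≤ v.2 * Real.cos β}

/-- The function `θ ↦ sin θ / (sin θ + cos θ)`. -/
noncomputable def angleValue (θ : ℝ) : ℝ := Real.sin θ / (Real.sin θ + Real.cos θ)

/-- `C` is the cone with angles `0 ≤ β ≤ α ≤ π / 2`; here `ab = (α, β)`. -/
def IsAngularCone (C : Set (ℝ × ℝ)) (ab : ℝ × ℝ) : Prop :=
  0 ≤ ab.2 ∧ ab.2 ≤ ab.1 ∧ ab.1 ≤ Real.pi / 2 ∧ C = angularCone ab.1 ab.2

open Classical in
/-- The value `[C] = sin α / (sin α + cos α) - sin β / (sin β + cos β)` of the cone `C` with angles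
`0 ≤ β ≤ α ≤ π / 2`. By `coneValue_angularCone` it does not depend on the representation. -/
noncomputable def coneValue (C : Set (ℝ × ℝ)) : ℝ :=
  if h : ∃ ab, IsAngularCone C ab then angleValue h.choose.1 - angleValue h.choose.2 else 0

theorem mem_angularCone_iff {α β θ : ℝ} (hβ : 0 ≤ β) (hα : α ≤ Real.pi / 2) (hαβ : β ≤ α)
    (h0 : 0 ≤ θ) (h1 : θ ≤ Real.pi / 2) :
    (Real.cos θ, Real.sin θ) ∈ angularCone α β ↔ β ≤ θ ∧ θ ≤ α := by
  have hpi := Real.pi_pos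
  have key : ∀ x y : ℝ, 0 ≤ x → x ≤ Real.pi / 2 → 0 ≤ y → y ≤ Real.pi / 2 →
      (Real.sin x * Real.cos y ≤ Real.cos x * Real.sin y ↔ x ≤ y) := by
    intro x y hx hx' hy hy'
    have e : Real.sin (y - x) = Real.cos x * Real.sin y - Real.sin x * Real.cos y := by
      rw [Real.sin_sub]; ring
    constructor
    · intro h
      by_contra hlt
      push Not at hlt
      have : Real.sin (y - x) < 0 :=
        Real.sin_neg_of_neg_of_neg_pi_lt (by linarith) (by linarith)
      linarith
    · intro h
      have : 0 ≤ Real.sin (y - x) := Real.sin_nonneg_of_nonneg_of_le_pi (by linarith) (by linarith)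
      linarith
  have hs : 0 ≤ Real.sin θ := Real.sin_nonneg_of_nonneg_of_le_pi h0 (by linarith)
  have hc : 0 ≤ Real.cos θ := Real.cos_nonneg_of_neg_pi_div_two_le_of_le (by linarith) h1
  have k1 := key θ α h0 h1 (by linarith) hα
  have k2 := key β θ hβ (by linarith) h0 h1
  have e1 : Real.cos θ * Real.sin β ≤ Real.sin θ * Real.cos β ↔ β ≤ θ := by
    rw [← k2, mul_comm (Real.cos θ), mul_comm (Real.sin θ)]
  simp only [angularCone, Set.mem_ofPred_eq, hs, hc, true_and, k1, e1]
  exact and_comm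

theorem coneValue_angularCone {α β : ℝ} (hβ : 0 ≤ β) (hαβ : β ≤ α) (hα : α ≤ Real.pi / 2) :
    coneValue (angularCone α β) = angleValue α - angleValue β := by
  have h : ∃ ab, IsAngularCone (angularCone α β) ab := ⟨(α, β), hβ, hαβ, hα, rfl⟩
  obtain ⟨g1, g2, g3, g4⟩ := h.choose_spec
  have a1 := (mem_angularCone_iff hβ hα hαβ (hβ.trans hαβ) hα).2 ⟨hαβ, le_rfl⟩
  have a2 := (mem_angularCone_iff hβ hα hαβ hβ (hαβ.trans hα)).2 ⟨le_rfl, hαβ⟩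
  have b1 := (mem_angularCone_iff g1 g3 g2 (g1.trans g2) g3).2 ⟨g2, le_rfl⟩
  have b2 := (mem_angularCone_iff g1 g3 g2 g1 (g2.trans g3)).2 ⟨le_rfl, g2⟩
  rw [g4, mem_angularCone_iff g1 g3 g2 (hβ.trans hαβ) hα] at a1
  rw [g4, mem_angularCone_iff g1 g3 g2 hβ (hαβ.trans hα)] at a2
  rw [← g4, mem_angularCone_iff hβ hα hαβ (g1.trans g2) g3] at b1
  rw [← g4, mem_angularCone_iff hβ hα hαβ g1 (g2.trans g3)] at b2
  rw [coneValue, dif_pos h, le_antisymm b1.2 a1.2, le_antisymm a2.1 b2.1]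

/-- Submodularity with respect to the fractional join `∑_{u ∈ E(p,q)} [C(u;p,q)] u`:
`f p + f q ≥ f (p ∧ q) + ∑_{u ∈ E(p,q)} [C(u;p,q)] f u` for all `p`, `q`. -/
def IsSubmodular {L : Type*} [SemilatticeInf L] (f : L → ℝ) : Prop :=
  ∀ p q : L, f (p ⊓ q) + ∑ᶠ u ∈ extremalSet p q, coneValue (normalCone p q u) * f u ≤ f p + f q

/-- The shortest path distance in the Hasse diagram of `L`, as a function on `L × L`. -/
noncomputable def hasseDist {L : Type*} [PartialOrder L] (x : L × L) : ℝ :=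
  ((SimpleGraph.hasse L).dist x.1 x.2 : ℝ)

end FracJoin

/-! Normalise a direction of the quadrant to `(1 - t, t)` with `t ∈ [0, 1]`. The angle `θ` becomes
`t = angleValue θ`, so the value of a normal cone is the length of the interval of those `t` for
which `u` is optimal. The fractional join is thus an average over `t` of optimal elements.
Optimality compares affine functions of `t` with integer coefficients, of slope at most `R = rank p
+ rank q`; nonconstant ones vanish at multiples of `1 / R!`. Hence one element `u j` per cell of the
grid of mesh `1 / R!` suffices (`IsOptimal.of_mem_cell`), and for `f ≥ 0` the fractional join costs
at most the mean of the `f (u j)` (`coneValue_le_card_div`).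

The mean is bounded by telescoping along the `u j` (`sum_le_of_isOptimal`). As `t` grows, traces on
`p` shrink and traces on `q` grow (`IsOptimal.antitone`), and two local inequalities enter: ordinary
submodularity when a join exists, and `f (u ⊓ u') ≤ (1 - τ) f u + τ f u'` for neighbours `u`, `u'`
meeting at the grid point `τ`.

For the distance, the first follows from modularity of the rank. The second (`hasseDist_inf_le`)
tests optimality of the pair on elements built from the meets of coordinates; their compatibility is
where the triple-join axiom is used. -/

namespace FracJoin

/-! ### Modular law without a bounding ideal, and modularity of the rank. -/

section Rank

variable {L : Type*} [SemilatticeInf L]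

theorem coe_rank {p : L} (h : Order.height p < ⊤) : (rank p : ℕ∞) = Order.height p :=
  ENat.natCast_toNat h.ne

theorem rank_lt_rank (hfin : ∀ p : L, Order.height p < ⊤) {p q : L} (h : p < q) :
    rank p < rank q := by
  have := Order.height_strictMono h (hfin p)
  rw [← coe_rank (hfin p), ← coe_rank (hfin q)] at this
  exact_mod_cast this

theorem rank_le_rank (hfin : ∀ p : L, Order.height p < ⊤) {p q : L} (h : p ≤ q) :
    rank p ≤ rank q := by
  rcases h.eq_or_lt with rfl | h
  · exact le_rfl
  · exact (rank_lt_rank hfin h).le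

theorem eq_of_le_of_rank_le (hfin : ∀ p : L, Order.height p < ⊤) {p q : L} (h : p ≤ q)
    (hr : rank q ≤ rank p) : p = q := by
  rcases h.eq_or_lt with h | h
  · exact h
  · exact absurd (rank_lt_rank hfin h) (by omega)

theorem exists_lt_rank_eq (hfin : ∀ p : L, Order.height p < ⊤) {p : L} {n : ℕ}
    (h : n < rank p) : ∃ q < p, rank q = n := by
  have h' : (n : ℕ∞) < Order.height p := by
    rw [← coe_rank (hfin p)]; exact_mod_cast h
  obtain ⟨q, hq, hn⟩ := (Order.coe_lt_height_iff (hfin p)).1 h'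
  refine ⟨q, hq, ?_⟩
  rw [← coe_rank (hfin q)] at hn
  exact_mod_cast hn

theorem exists_covBy_ge (hfin : ∀ p : L, Order.height p < ⊤) {x y : L} (h : x < y) :
    ∃ z, x ≤ z ∧ z ⋖ y := by
  induction hn : rank y - rank x using Nat.strong_induction_on generalizing x with
  | _ n ih =>
    by_cases hc : x ⋖ y
    · exact ⟨x, le_rfl, hc⟩
    · obtain ⟨c, h1, h2⟩ := (not_covBy_iff h).1 hc
      have := rank_lt_rank hfin h1
      have := rank_lt_rank hfin h2
      obtain ⟨z, hz, hz'⟩ := ih (rank y - rank c) (by omega) h2 rfl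
      exact ⟨z, h1.le.trans hz, hz'⟩

theorem IsModularSemilattice.exists_isLUB (hL : IsModularSemilattice L) {a b c : L}
    (ha : a ≤ c) (hb : b ≤ c) : ∃ s, IsLUB {a, b} s :=
  hL.exists_sup_of_le c a b ha hb

theorem isLUB_pair_iff {a b s : L} :
    IsLUB {a, b} s ↔ a ≤ s ∧ b ≤ s ∧ ∀ c, a ≤ c → b ≤ c → s ≤ c := by
  simp only [IsLUB, IsLeast, mem_upperBounds, lowerBounds, Set.mem_ofPred_eq,
    Set.mem_insert_iff, Set.mem_singleton_iff, forall_eq_or_imp, forall_eq]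
  tauto

theorem IsModularSemilattice.modular (hL : IsModularSemilattice L) {x y z s : L} (hz : z ≤ x)
    (h : IsLUB {y, z} s) : IsLUB {x ⊓ y, z} (x ⊓ s) := by
  obtain ⟨hy, hzs, -⟩ := isLUB_pair_iff.1 h
  have := hL.modular_of_le s (x ⊓ s) y z s inf_le_right hy (le_inf hz hzs) h
  rwa [inf_assoc, inf_eq_right.2 hy, inf_assoc, inf_idem] at this

theorem IsModularSemilattice.inf_eq (hL : IsModularSemilattice L) {x y z s : L} (hz : z ≤ x)
    (hxy : x ⊓ y ≤ z) (h : IsLUB {y, z} s) : x ⊓ s = z := by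
  have := isLUB_pair_iff.1 (hL.modular hz h)
  exact le_antisymm (this.2.2 z hxy le_rfl) this.2.1

theorem IsModularSemilattice.exists_bound (hL : IsModularSemilattice L) {x y z : L}
    (h1 : ∃ c, x ≤ c ∧ y ≤ c) (h2 : ∃ c, y ≤ c ∧ z ≤ c) (h3 : ∃ c, z ≤ c ∧ x ≤ c) :
    ∃ c, x ≤ c ∧ y ≤ c ∧ z ≤ c := by
  obtain ⟨c1, ha1, hb1⟩ := h1
  obtain ⟨c2, ha2, hb2⟩ := h2
  obtain ⟨c3, ha3, hb3⟩ := h3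
  obtain ⟨s, hs⟩ := hL.exists_sup_triple x y z (hL.exists_isLUB ha1 hb1)
    (hL.exists_isLUB ha2 hb2) (hL.exists_isLUB ha3 hb3)
  exact ⟨s, hs.1 (by simp), hs.1 (by simp), hs.1 (by simp)⟩

/-- Jordan–Dedekind argument: compare `x` with some `z < y` of rank `rank y - 1`. If `z` is not
below `x`, modularity makes `x ⊓ z` a lower cover of both, and induction gives `x` and `z` equal
rank. -/
theorem rank_covBy (hL : IsModularSemilattice L) (hfin : ∀ p : L, Order.height p < ⊤) {x y : L}
    (h : x ⋖ y) : rank y = rank x + 1 := by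
  induction hn : rank y using Nat.strong_induction_on generalizing x y with
  | _ n ih =>
    have hxy := rank_lt_rank hfin h.lt
    obtain ⟨z, hz, hzn⟩ := exists_lt_rank_eq hfin (p := y) (n := n - 1) (by omega)
    by_cases hzx : z ≤ x
    · have := rank_le_rank hfin hzx
      omega
    have hxz : ¬ x ≤ z := fun hxz => by
      rcases h.eq_or_eq hxz hz.le with e | e
      · exact hzx e.le
      · exact hz.ne e
    have c1 : x ⊓ z ⋖ x := by
      refine ⟨lt_of_le_of_ne inf_le_left (by simpa using hxz), fun c hc hcx => ?_⟩
      obtain ⟨s, hs⟩ := hL.exists_isLUB hz.le (hcx.le.trans h.le)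
      obtain ⟨h1, h2, h3⟩ := isLUB_pair_iff.1 hs
      have e := hL.inf_eq hcx.le hc.le hs
      have hsy : s ≤ y := h3 y hz.le (hcx.le.trans h.le)
      have hzs : z < s := lt_of_le_of_ne h1 fun e' => by
        subst e'; exact hc.ne e
      have := rank_lt_rank hfin hzs
      have : s = y := eq_of_le_of_rank_le hfin hsy (by omega)
      subst this
      rw [inf_eq_left.2 h.le] at e
      exact hcx.ne e.symm
    have c2 : x ⊓ z ⋖ z := by
      refine ⟨lt_of_le_of_ne inf_le_right (by simpa using hzx), fun c hc hcz => ?_⟩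
      obtain ⟨s, hs⟩ := hL.exists_isLUB h.le (hcz.le.trans hz.le)
      obtain ⟨h1, h2, h3⟩ := isLUB_pair_iff.1 hs
      have e := hL.inf_eq hcz.le (by rw [inf_comm]; exact hc.le) hs
      have hsy : s ≤ y := h3 y h.le (hcz.le.trans hz.le)
      rcases h.eq_or_eq h1 hsy with e' | e'
      · subst e'; rw [inf_comm] at e; exact hc.ne e
      · subst e'; rw [inf_eq_left.2 hz.le] at e; exact hcz.ne e.symm
    have := ih (rank x) (by omega) c1 rfl
    have := ih (rank z) (by omega) c2 rfl
    omega

/-- Replacing `b` by a lower cover `b'` above `a ⊓ b` keeps the meet with `a` and, by modularity,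
lowers the join by exactly one cover. -/
theorem rank_add_rank (hL : IsModularSemilattice L) (hfin : ∀ p : L, Order.height p < ⊤)
    {a b s : L} (h : IsLUB {a, b} s) : rank a + rank b = rank (a ⊓ b) + rank s := by
  induction hn : rank b using Nat.strong_induction_on generalizing b s with
  | _ n ih =>
    obtain ⟨has, hbs, hs⟩ := isLUB_pair_iff.1 h
    by_cases hba : b ≤ a
    · have : s = a := le_antisymm (hs a le_rfl hba) has
      rw [inf_eq_right.2 hba, this, hn, add_comm]
    obtain ⟨b', hb', hc⟩ := exists_covBy_ge hfin
      (lt_of_le_of_ne (inf_le_right : a ⊓ b ≤ b) (by simpa using hba))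
    obtain ⟨s', hs'⟩ := hL.exists_isLUB has (hc.le.trans hbs)
    obtain ⟨ha', hbs', hl'⟩ := isLUB_pair_iff.1 hs'
    have hs's : s' ≤ s := hl' s has (hc.le.trans hbs)
    have e1 : b ⊓ s' = b' := hL.inf_eq hc.le (by rwa [inf_comm]) hs'
    have hr := rank_covBy hL hfin hc
    have e2 : a ⊓ b' = a ⊓ b :=
      le_antisymm (inf_le_inf_left a hc.le) (le_inf inf_le_left hb')
    have h1 := ih (rank b') (by omega) hs' rfl
    rw [e2] at h1
    have hcov : s' ⋖ s := by
      refine ⟨lt_of_le_of_ne hs's fun e => ?_, fun c h1 h2 => ?_⟩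
      · rw [e, inf_eq_left.2 hbs] at e1
        exact hc.ne e1.symm
      · have hbc : b' ≤ b ⊓ c := le_inf hc.le (hbs'.trans h1.le)
        rcases hc.eq_or_eq hbc inf_le_left with e | e
        · have hlub : IsLUB {b, s'} s := isLUB_pair_iff.2
            ⟨hbs, hs's, fun d hd hd' => hs d (ha'.trans hd') hd⟩
          have := hL.inf_eq h1.le (by rw [inf_comm, e]; exact hbs') hlub
          rw [inf_eq_left.2 h2.le] at this
          exact h1.ne this.symm
        · exact absurd (hs c (ha'.trans h1.le) (inf_eq_left.1 e)) (not_le_of_gt h2)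
    have := rank_covBy hL hfin hcov
    omega

theorem rank_add_rank_le (hL : IsModularSemilattice L) (hfin : ∀ p : L, Order.height p < ⊤)
    {a b c : L} (ha : a ≤ c) (hb : b ≤ c) : rank a + rank b ≤ rank (a ⊓ b) + rank c := by
  obtain ⟨s, hs⟩ := hL.exists_isLUB ha hb
  rw [rank_add_rank hL hfin hs]
  have := rank_le_rank hfin ((isLUB_pair_iff.1 hs).2.2 c ha hb)
  omega

end Rank

/-! ### Products: modularity and additivity of the rank. -/

section Prod

theorem isLUB_pair_prod {α β : Type*} [SemilatticeInf α] [SemilatticeInf β] {a b s : α × β} :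
    IsLUB {a, b} s ↔ IsLUB {a.1, b.1} s.1 ∧ IsLUB {a.2, b.2} s.2 := by
  rw [isLUB_prod, Set.image_pair, Set.image_pair]

theorem IsModularSemilattice.prod {α β : Type*} [SemilatticeInf α] [SemilatticeInf β]
    (hα : IsModularSemilattice α) (hβ : IsModularSemilattice β) :
    IsModularSemilattice (α × β) where
  exists_sup_of_le p x y hx hy := by
    obtain ⟨s, hs⟩ := hα.exists_isLUB hx.1 hy.1
    obtain ⟨t, ht⟩ := hβ.exists_isLUB hx.2 hy.2
    exact ⟨(s, t), isLUB_pair_prod.2 ⟨hs, ht⟩⟩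
  modular_of_le p x y z s _ _ hz h := by
    rw [isLUB_pair_prod] at h ⊢
    exact ⟨hα.modular hz.1 h.1, hβ.modular hz.2 h.2⟩
  exists_sup_triple x y z := by
    rintro ⟨s, hs⟩ ⟨t, ht⟩ ⟨u, hu⟩
    rw [isLUB_pair_prod] at hs ht hu
    obtain ⟨v, hv⟩ := hα.exists_sup_triple x.1 y.1 z.1 ⟨_, hs.1⟩ ⟨_, ht.1⟩ ⟨_, hu.1⟩
    obtain ⟨w, hw⟩ := hβ.exists_sup_triple x.2 y.2 z.2 ⟨_, hs.2⟩ ⟨_, ht.2⟩ ⟨_, hu.2⟩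
    refine ⟨(v, w), ?_⟩
    rw [isLUB_prod]
    simp only [Set.image_insert_eq, Set.image_singleton]
    exact ⟨hv, hw⟩

variable {α β : Type*} [SemilatticeInf α] [SemilatticeInf β]

theorem height_prod_le (hα : ∀ p : α, Order.height p < ⊤) (hβ : ∀ p : β, Order.height p < ⊤)
    (x : α × β) : Order.height x ≤ ((rank x.1 + rank x.2 : ℕ) : ℕ∞) := by
  have hmono : StrictMono fun x : α × β => rank x.1 + rank x.2 := by
    intro x y h
    rcases Prod.lt_iff.1 h with ⟨h1, h2⟩ | ⟨h1, h2⟩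
    · exact add_lt_add_of_lt_of_le (rank_lt_rank hα h1) (rank_le_rank hβ h2)
    · exact add_lt_add_of_le_of_lt (rank_le_rank hα h1) (rank_lt_rank hβ h2)
  simpa using Order.height_le_height_apply_of_strictMono _ hmono x

theorem height_prod_lt_top (hα : ∀ p : α, Order.height p < ⊤)
    (hβ : ∀ p : β, Order.height p < ⊤) (x : α × β) : Order.height x < ⊤ :=
  (height_prod_le hα hβ x).trans_lt (ENat.natCast_lt_top _)

theorem rank_prod (hα : ∀ p : α, Order.height p < ⊤) (hβ : ∀ p : β, Order.height p < ⊤)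
    (x : α × β) : rank x = rank x.1 + rank x.2 := by
  have hf := height_prod_lt_top hα hβ
  apply le_antisymm
  · have := height_prod_le hα hβ x
    rw [← coe_rank (hf x)] at this
    exact_mod_cast this
  · obtain ⟨a, b⟩ := x
    change rank a + rank b ≤ _
    induction hn : rank a + rank b generalizing a b with
    | zero => exact Nat.zero_le _
    | succ n ih =>
      rcases Nat.eq_zero_or_pos (rank a) with h0 | h0
      · obtain ⟨c, hc, hr⟩ := exists_lt_rank_eq hβ (p := b) (n := n) (by omega)
        have := ih a c (by omega)
        have := rank_lt_rank hf (Prod.mk_lt_mk_iff_right.2 hc : (a, c) < (a, b))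
        omega
      · obtain ⟨c, hc, hr⟩ := exists_lt_rank_eq hα (p := a) (n := rank a - 1) (by omega)
        have := ih c b (by omega)
        have := rank_lt_rank hf (Prod.mk_lt_mk_iff_left.2 hc : (c, b) < (a, b))
        omega

end Prod

/-! ### The Hasse distance and its two local inequalities. -/

section Hasse

variable {L : Type*} [SemilatticeInf L]

theorem exists_walk_of_le (hL : IsModularSemilattice L) (hfin : ∀ p : L, Order.height p < ⊤)
    {x y : L} (h : x ≤ y) : ∃ w : (SimpleGraph.hasse L).Walk x y, w.length + rank x = rank y := by
  induction hn : rank y using Nat.strong_induction_on generalizing y with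
  | _ n ih =>
    rcases h.eq_or_lt with rfl | h
    · exact ⟨.nil, by simpa using hn⟩
    · obtain ⟨z, hz, hc⟩ := exists_covBy_ge hfin h
      have hr := rank_covBy hL hfin hc
      obtain ⟨w, hw⟩ := ih (rank z) (by omega) hz rfl
      refine ⟨w.concat (SimpleGraph.hasse_adj.2 (Or.inl hc)), ?_⟩
      rw [SimpleGraph.Walk.length_concat]
      omega

theorem rank_inf_covBy (hL : IsModularSemilattice L) (hfin : ∀ p : L, Order.height p < ⊤)
    (p : L) {x y : L} (h : x ⋖ y) : rank (p ⊓ y) ≤ rank (p ⊓ x) + 1 := by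
  have h1 := rank_add_rank_le hL hfin (inf_le_right : p ⊓ y ≤ y) h.le
  rw [inf_assoc, inf_eq_right.2 h.le] at h1
  have := rank_covBy hL hfin h
  omega

/-- With the end `q` fixed, each edge changes `rank x + rank q - 2 * rank (x ⊓ q)` by at most 1:
`rank (x ⊓ q)` moves by 0 or 1 in the same direction as `rank x`. -/
theorem rank_add_rank_le_length (hL : IsModularSemilattice L)
    (hfin : ∀ p : L, Order.height p < ⊤) {p q : L} (w : (SimpleGraph.hasse L).Walk p q) :
    rank p + rank q ≤ 2 * rank (p ⊓ q) + w.length := by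
  induction w with
  | nil => simp; omega
  | @cons x y z h w ih =>
    rw [SimpleGraph.Walk.length_cons]
    rcases h with h | h
    · have h1 := rank_inf_covBy hL hfin z h
      have h2 := rank_covBy hL hfin h
      rw [inf_comm z, inf_comm z] at h1
      omega
    · have h2 := rank_covBy hL hfin h
      have h1 := rank_le_rank hfin (inf_le_inf_right z h.le)
      omega

theorem hasse_reachable_and_dist (hL : IsModularSemilattice L)
    (hfin : ∀ p : L, Order.height p < ⊤) (p q : L) :
    (SimpleGraph.hasse L).Reachable p q ∧
      hasseDist (p, q) = (rank p : ℝ) + rank q - 2 * rank (p ⊓ q) := by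
  obtain ⟨w1, h1⟩ := exists_walk_of_le hL hfin (inf_le_left : p ⊓ q ≤ p)
  obtain ⟨w2, h2⟩ := exists_walk_of_le hL hfin (inf_le_right : p ⊓ q ≤ q)
  let w := w1.reverse.append w2
  have hw : w.length = w1.length + w2.length := by simp [w]
  refine ⟨⟨w⟩, ?_⟩
  obtain ⟨w', hw'⟩ := SimpleGraph.Reachable.exists_walk_length_eq_dist ⟨w⟩
  have h3 := rank_add_rank_le_length hL hfin w'
  have h4 := SimpleGraph.dist_le w
  have h5 : (SimpleGraph.hasse L).dist p q + 2 * rank (p ⊓ q) = rank p + rank q := by omega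
  have h6 : ((SimpleGraph.hasse L).dist p q : ℝ) + 2 * rank (p ⊓ q) = rank p + rank q := by
    exact_mod_cast h5
  simp only [hasseDist]
  linarith

/-- Submodularity on pairs with a join. -/
theorem hasseDist_inf_add_sup_le (hL : IsModularSemilattice L)
    (hfin : ∀ p : L, Order.height p < ⊤) {p q s : L × L} (h : IsLUB {p, q} s) :
    hasseDist (p ⊓ q) + hasseDist s ≤ hasseDist p + hasseDist q := by
  obtain ⟨p1, p2⟩ := p
  obtain ⟨q1, q2⟩ := q
  obtain ⟨s1, s2⟩ := s
  obtain ⟨h1, h2⟩ := isLUB_pair_prod.1 h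
  have e1 := rank_add_rank hL hfin h1
  have e2 := rank_add_rank hL hfin h2
  have l1 := isLUB_pair_iff.1 h1
  have l2 := isLUB_pair_iff.1 h2
  dsimp only at e1 e2 l1 l2
  have e3 : rank (p1 ⊓ p2) + rank (q1 ⊓ q2) ≤ rank ((p1 ⊓ q1) ⊓ (p2 ⊓ q2)) + rank (s1 ⊓ s2) := by
    rw [inf_inf_inf_comm]
    exact rank_add_rank_le hL hfin (inf_le_inf l1.1 l2.1) (inf_le_inf l1.2.1 l2.2.1)
  rw [Prod.mk_inf_mk, (hasse_reachable_and_dist hL hfin _ _).2,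
    (hasse_reachable_and_dist hL hfin _ _).2, (hasse_reachable_and_dist hL hfin _ _).2,
    (hasse_reachable_and_dist hL hfin _ _).2]
  rify at e1 e2 e3
  linarith

/-- Convexity along a pair whose two members are optimal in the direction `(1 - τ, τ)`. -/
theorem hasseDist_inf_le (hL : IsModularSemilattice L)
    (hfin : ∀ p : L, Order.height p < ⊤) {u u' : L × L} {τ : ℝ}
    (h1 : (1 - τ) * ((rank u : ℝ) - rank (u ⊓ u')) = τ * (rank u' - rank (u ⊓ u')))
    (h2 : ∀ c e, u ⊓ u' ≤ c → c ≤ u → u ⊓ u' ≤ e → e ≤ u' → (∃ b, c ≤ b ∧ e ≤ b) →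
      (1 - τ) * ((rank c : ℝ) - rank (u ⊓ u')) + τ * (rank e - rank (u ⊓ u')) ≤
        (1 - τ) * ((rank u : ℝ) - rank (u ⊓ u'))) :
    hasseDist (u ⊓ u') ≤ (1 - τ) * hasseDist u + τ * hasseDist u' := by
  obtain ⟨p1, p2⟩ := u
  obtain ⟨q1, q2⟩ := u'
  have hr := rank_prod hfin hfin
  rw [Prod.mk_inf_mk] at *
  have v1p : p1 ⊓ q1 ≤ p1 := inf_le_left
  have v1q : p1 ⊓ q1 ≤ q1 := inf_le_right
  have v2p : p2 ⊓ q2 ≤ p2 := inf_le_left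
  have v2q : p2 ⊓ q2 ≤ q2 := inf_le_right
  have sp1 : p1 ⊓ p2 ≤ p1 := inf_le_left
  have sp2 : p1 ⊓ p2 ≤ p2 := inf_le_right
  have tq1 : q1 ⊓ q2 ≤ q1 := inf_le_left
  have tq2 : q1 ⊓ q2 ≤ q2 := inf_le_right
  have stp : (q1 ⊓ q2) ⊓ p2 ≤ p2 := inf_le_right
  have stq : (q1 ⊓ q2) ⊓ p2 ≤ q1 := inf_le_left.trans tq1
  have tsp : (p1 ⊓ p2) ⊓ q1 ≤ p2 := inf_le_left.trans sp2
  have tsq : (p1 ⊓ p2) ⊓ q1 ≤ q1 := inf_le_right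
  -- Test elements `c = (c1, c2)` and `e = (e1, e2)`: adjoin `p1 ⊓ p2`, respectively `q1 ⊓ q2`, to
  -- `u ⊓ u'`, cutting one coordinate down so that `c` and `e` stay compatible. The cut terms cancel
  -- in the ranks: `c` and `e` exceed `u ⊓ u'` by the excess of `p1 ⊓ p2`, respectively `q1 ⊓ q2`,
  -- over the meet of all four coordinates.
  obtain ⟨c1, hc1⟩ := hL.exists_isLUB sp1 v1p
  obtain ⟨c2, hc2⟩ := hL.exists_isLUB tsp v2p
  obtain ⟨e1, he1⟩ := hL.exists_isLUB stq v1q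
  obtain ⟨e2, he2⟩ := hL.exists_isLUB tq2 v2q
  obtain ⟨b1, hb1, hb1', hb1''⟩ := hL.exists_bound ⟨p2, sp2, stp⟩ ⟨q1, stq, v1q⟩ ⟨p1, v1p, sp1⟩
  obtain ⟨b2, hb2, hb2', hb2''⟩ := hL.exists_bound ⟨q1, tsq, tq1⟩ ⟨q2, tq2, v2q⟩ ⟨p2, v2p, tsp⟩
  have rc1 := rank_add_rank hL hfin hc1
  have rc2 := rank_add_rank hL hfin hc2
  have re1 := rank_add_rank hL hfin he1
  have re2 := rank_add_rank hL hfin he2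
  rw [isLUB_pair_iff] at hc1 hc2 he1 he2
  have key := h2 (c1, c2) (e1, e2) ⟨hc1.2.1, hc2.2.1⟩
    ⟨hc1.2.2 _ sp1 v1p, hc2.2.2 _ tsp v2p⟩ ⟨he1.2.1, he2.2.1⟩
    ⟨he1.2.2 _ stq v1q, he2.2.2 _ tq2 v2q⟩
    ⟨(b1, b2), ⟨hc1.2.2 _ hb1 hb1'', hc2.2.2 _ hb2 hb2''⟩,
      ⟨he1.2.2 _ hb1' hb1'', he2.2.2 _ hb2' hb2''⟩⟩
  have m1 : p1 ⊓ p2 ⊓ (p1 ⊓ q1) = p1 ⊓ p2 ⊓ q1 := by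
    rw [← inf_assoc, inf_eq_left.2 (sp1 : p1 ⊓ p2 ≤ p1)]
  have m2 : p1 ⊓ p2 ⊓ q1 ⊓ (p2 ⊓ q2) = p1 ⊓ q1 ⊓ (p2 ⊓ q2) := by
    rw [← inf_assoc, inf_eq_left.2 tsp]; ac_rfl
  have m3 : q1 ⊓ q2 ⊓ p2 ⊓ (p1 ⊓ q1) = p1 ⊓ q1 ⊓ (p2 ⊓ q2) := by
    rw [inf_comm p1, ← inf_assoc, inf_eq_left.2 stq]; ac_rfl
  have m4 : q1 ⊓ q2 ⊓ (p2 ⊓ q2) = q1 ⊓ q2 ⊓ p2 := by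
    rw [inf_comm p2, ← inf_assoc, inf_eq_left.2 (tq2 : q1 ⊓ q2 ≤ q2)]
  rw [m1] at rc1
  rw [m2] at rc2
  rw [m3] at re1
  rw [m4] at re2
  simp only [hr] at h1 key
  push_cast at h1 key
  rify at rc1 rc2 re1 re2
  rw [(hasse_reachable_and_dist hL hfin _ _).2,
    (hasse_reachable_and_dist hL hfin _ _).2, (hasse_reachable_and_dist hL hfin _ _).2]
  have kc : (rank c1 : ℝ) + rank c2 =
    rank (p1 ⊓ p2) + rank (p1 ⊓ q1) + rank (p2 ⊓ q2) - rank (p1 ⊓ q1 ⊓ (p2 ⊓ q2)) := by linarith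
  have ke : (rank e1 : ℝ) + rank e2 =
    rank (q1 ⊓ q2) + rank (p1 ⊓ q1) + rank (p2 ⊓ q2) - rank (p1 ⊓ q1 ⊓ (p2 ⊓ q2)) := by linarith
  rw [kc, ke] at key
  linarith

end Hasse

/-! ### Exchange in `I(p,q)`, finiteness of `E(p,q)`, optimal elements. -/

section JoinSet

variable {M : Type*} [SemilatticeInf M]

theorem mem_joinSet (hM : IsModularSemilattice M) {p q u : M} (hu : u ∈ joinSet p q) :
    p ⊓ q ≤ u ∧ IsLUB {u ⊓ p, u ⊓ q} u := by
  obtain ⟨a, b, hpa, hap, hpb, hbq, h⟩ := hu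
  have l := isLUB_pair_iff.1 h
  have ea : p ⊓ u = a := hM.inf_eq hap ((inf_le_inf_left p hbq).trans hpa)
    (by rwa [Set.pair_comm])
  have eb : q ⊓ u = b := hM.inf_eq hbq
    ((inf_le_inf_left q hap).trans ((inf_comm q p).le.trans hpb)) h
  refine ⟨hpa.trans l.1, ?_⟩
  rwa [inf_comm u p, inf_comm u q, ea, eb]

theorem exists_mem_joinSet (hM : IsModularSemilattice M) {p q a b : M} (h1 : p ⊓ q ≤ a)
    (h2 : a ≤ p) (h3 : p ⊓ q ≤ b) (h4 : b ≤ q) (h : ∃ c, a ≤ c ∧ b ≤ c) :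
    ∃ u ∈ joinSet p q, u ⊓ p = a ∧ u ⊓ q = b := by
  obtain ⟨c, hac, hbc⟩ := h
  obtain ⟨u, hu⟩ := hM.exists_isLUB hac hbc
  refine ⟨u, ⟨a, b, h1, h2, h3, h4, hu⟩, ?_, ?_⟩
  · rw [inf_comm]
    exact hM.inf_eq h2 ((inf_le_inf_left p h4).trans h1) (by rwa [Set.pair_comm])
  · rw [inf_comm]
    exact hM.inf_eq h4 ((inf_le_inf_left q h2).trans ((inf_comm q p).le.trans h3)) hu

theorem le_inf_of_mem_joinSet (hM : IsModularSemilattice M) {p q u : M} (hu : u ∈ joinSet p q) :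
    p ⊓ q ≤ u ⊓ p ∧ p ⊓ q ≤ u ⊓ q :=
  ⟨le_inf (mem_joinSet hM hu).1 inf_le_left, le_inf (mem_joinSet hM hu).1 inf_le_right⟩

/-- Two members of the join set have the same traces on `p` and `q` only if they agree. -/
theorem joinSet_ext (hM : IsModularSemilattice M) {p q u w : M} (hu : u ∈ joinSet p q)
    (hw : w ∈ joinSet p q) (h1 : u ⊓ p = w ⊓ p) (h2 : u ⊓ q = w ⊓ q) : u = w := by
  have hu' := (mem_joinSet hM hu).2
  rw [h1, h2] at hu'
  exact hu'.unique (mem_joinSet hM hw).2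

/-- Exchange between members of the join set. -/
theorem exists_exchange (hM : IsModularSemilattice M) (hfin : ∀ p : M, Order.height p < ⊤)
    {p q u w : M} (hu : u ∈ joinSet p q) (hw : w ∈ joinSet p q) :
    ∃ z ∈ joinSet p q,
      rank (z ⊓ p) + rank (u ⊓ w ⊓ p) = rank (u ⊓ p) + rank (w ⊓ p) ∧
      z ⊓ q = u ⊓ w ⊓ q := by
  obtain ⟨a1, a2⟩ := le_inf_of_mem_joinSet hM hu
  obtain ⟨b1, b2⟩ := le_inf_of_mem_joinSet hM hw
  obtain ⟨s, hs⟩ := hM.exists_isLUB (inf_le_right : u ⊓ p ≤ p) (inf_le_right : w ⊓ p ≤ p)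
  have l := isLUB_pair_iff.1 hs
  have i1 : u ⊓ w ⊓ q ≤ u := inf_le_left.trans inf_le_left
  have i2 : u ⊓ w ⊓ q ≤ w := inf_le_left.trans inf_le_right
  -- The three pairs are bounded by `p`, `w` and `u`, so the larger trace on `p` is compatible with
  -- the smaller one on `q`.
  obtain ⟨c, h1, h2, h3⟩ := hM.exists_bound (x := u ⊓ p) (y := w ⊓ p) (z := u ⊓ w ⊓ q)
    ⟨p, inf_le_right, inf_le_right⟩ ⟨w, inf_le_left, i2⟩ ⟨u, i1, inf_le_left⟩
  obtain ⟨z, hz, e1, e2⟩ := exists_mem_joinSet hM (p := p) (q := q) (a := s) (b := u ⊓ w ⊓ q)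
    (a1.trans l.1) (l.2.2 p inf_le_right inf_le_right)
    (le_inf (le_inf (mem_joinSet hM hu).1 (mem_joinSet hM hw).1) inf_le_right) inf_le_right
    ⟨c, l.2.2 c h1 h2, h3⟩
  refine ⟨z, hz, ?_, e2⟩
  have := rank_add_rank hM hfin hs
  rw [← inf_inf_distrib_right] at this
  rw [e1]
  omega

theorem left_mem_joinSet (p q : M) : p ∈ joinSet p q :=
  ⟨p, p ⊓ q, inf_le_left, le_rfl, le_rfl, inf_le_right,
    isLUB_pair_iff.2 ⟨le_rfl, inf_le_left, fun _ h _ => h⟩⟩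

theorem joinSet_comm (p q : M) : joinSet p q = joinSet q p := by
  ext u
  constructor <;>
  · rintro ⟨a, b, h1, h2, h3, h4, h⟩
    exact ⟨b, a, by rwa [inf_comm], h4, by rwa [inf_comm], h2, by rwa [Set.pair_comm]⟩

theorem exists_exchange' (hM : IsModularSemilattice M) (hfin : ∀ p : M, Order.height p < ⊤)
    {p q u w : M} (hu : u ∈ joinSet p q) (hw : w ∈ joinSet p q) :
    ∃ z ∈ joinSet p q, z ⊓ p = u ⊓ w ⊓ p ∧
      rank (z ⊓ q) + rank (u ⊓ w ⊓ q) = rank (u ⊓ q) + rank (w ⊓ q) := by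
  rw [joinSet_comm] at hu hw ⊢
  obtain ⟨z, hz, h1, h2⟩ := exists_exchange hM hfin hu hw
  exact ⟨z, hz, h2, h1⟩

theorem inf_le_of_rank_le (hfin : ∀ p : M, Order.height p < ⊤) {x y p : M}
    (h : rank (x ⊓ p) ≤ rank (x ⊓ y ⊓ p)) : x ⊓ p ≤ y ⊓ p := by
  have : x ⊓ y ⊓ p = x ⊓ p :=
    eq_of_le_of_rank_le hfin (inf_le_inf_right p inf_le_left) h
  rw [← this]
  exact inf_le_inf_right p inf_le_right

/-- The common rank vector is the midpoint of those of the two exchange elements. Extremality makes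
all of them equal, so `u ⊓ w` has the full traces of both `u` and `w`. -/
theorem eq_of_rankVec_eq (hM : IsModularSemilattice M) (hfin : ∀ p : M, Order.height p < ⊤)
    {p q u w : M} (hu : u ∈ joinSet p q) (hw : w ∈ joinSet p q)
    (he : rankVec p q u ∈ (hull p q).extremePoints ℝ)
    (h : rankVec p q w = rankVec p q u) : u = w := by
  obtain ⟨z, hz, z1, z2⟩ := exists_exchange hM hfin hu hw
  obtain ⟨z', hz', z1', z2'⟩ := exists_exchange' hM hfin hu hw
  have hh : ∀ x ∈ joinSet p q, rankVec p q x ∈ hull p q :=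
    fun x hx => subset_convexHull ℝ _ ⟨x, hx, rfl⟩
  have h1 := congrArg Prod.fst h
  have h2 := congrArg Prod.snd h
  simp only [rankVec, sub_left_inj, Nat.cast_inj] at h1 h2
  have key := (mem_extremePoints.1 he).2 _ (hh z hz) _ (hh z' hz') (by
    refine ⟨1 / 2, 1 / 2, by norm_num, by norm_num, by norm_num, ?_⟩
    rify at z1 z2' h1 h2
    simp only [rankVec, z2, z1', Prod.smul_mk, Prod.mk_add_mk, smul_eq_mul]
    ext
    · simp only; linarith
    · simp only; linarith)
  have k1 := congrArg Prod.fst key.1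
  have k2 := congrArg Prod.snd key.1
  simp only [rankVec, z2, sub_left_inj, Nat.cast_inj] at k1 k2
  have e1 : u ⊓ w ⊓ p = u ⊓ p :=
    eq_of_le_of_rank_le hfin (inf_le_inf_right p inf_le_left) (by omega)
  have e2 : u ⊓ w ⊓ p = w ⊓ p :=
    eq_of_le_of_rank_le hfin (inf_le_inf_right p inf_le_right) (by omega)
  have e3 : u ⊓ w ⊓ q = u ⊓ q :=
    eq_of_le_of_rank_le hfin (inf_le_inf_right q inf_le_left) (by omega)
  have e4 : u ⊓ w ⊓ q = w ⊓ q :=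
    eq_of_le_of_rank_le hfin (inf_le_inf_right q inf_le_right) (by omega)
  exact joinSet_ext hM hu hw (e1.symm.trans e2) (e3.symm.trans e4)

theorem finite_image_ranks (hfin : ∀ p : M, Order.height p < ⊤) (p q : M) (S : Set M) :
    ((fun u => (rank (u ⊓ p), rank (u ⊓ q))) '' S).Finite := by
  refine (Set.finite_Iic (rank p, rank q)).subset ?_
  rintro _ ⟨u, -, rfl⟩
  exact ⟨rank_le_rank hfin inf_le_right, rank_le_rank hfin inf_le_right⟩

theorem finite_extremalSet (hM : IsModularSemilattice M) (hfin : ∀ p : M, Order.height p < ⊤)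
    (p q : M) : (extremalSet p q).Finite := by
  refine Set.Finite.of_finite_image (finite_image_ranks hfin p q _) ?_
  intro u hu w hw h
  simp only [Prod.mk.injEq] at h
  refine eq_of_rankVec_eq hM hfin hu.1 hw.1 hu.2.prop ?_
  rw [rankVec, rankVec, h.1, h.2]

/-- The value of `u` in the direction `(1 - t, t)`. -/
noncomputable def directedRank (p q : M) (t : ℝ) (u : M) : ℝ :=
  (1 - t) * rank (u ⊓ p) + t * rank (u ⊓ q)

/-- `u` maximizes the direction `(1 - t, t)` over the join set. -/
def IsOptimal (p q : M) (t : ℝ) (u : M) : Prop :=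
  u ∈ joinSet p q ∧ ∀ w ∈ joinSet p q, directedRank p q t w ≤ directedRank p q t u

theorem exists_isOptimal (hfin : ∀ p : M, Order.height p < ⊤) (p q : M) (t : ℝ) :
    ∃ u, IsOptimal p q t u := by
  obtain ⟨_, ⟨u, hu, rfl⟩, h⟩ := Set.exists_max_image _
    (fun x : ℕ × ℕ => (1 - t) * (x.1 : ℝ) + t * x.2) (finite_image_ranks hfin p q (joinSet p q))
    ⟨_, p, left_mem_joinSet p q, rfl⟩
  exact ⟨u, hu, fun w hw => h _ ⟨w, hw, rfl⟩⟩

theorem IsOptimal.of_mem_Icc {p q u : M} {s s' m : ℝ} (h : IsOptimal p q s u)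
    (h' : IsOptimal p q s' u) (hm : s ≤ m) (hm' : m ≤ s') (hs : s < s') :
    IsOptimal p q m u := by
  refine ⟨h.1, fun w hw => ?_⟩
  have h1 := mul_le_mul_of_nonneg_left (h.2 w hw) (sub_nonneg.2 hm')
  have h2 := mul_le_mul_of_nonneg_left (h'.2 w hw) (sub_nonneg.2 hm)
  simp only [directedRank] at *
  refine le_of_mul_le_mul_left ?_ (sub_pos.2 hs)
  linarith

/-- Test `u` at `t` and `u'` at `t'` against the two exchange elements. Adding the inequalities
gives `(t' - t) * (x + y) ≤ 0`, where `x, y ≥ 0` are the rank losses in passing from `u' ⊓ p` and `u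
⊓ q` to the traces of `u ⊓ u'`. -/
theorem IsOptimal.antitone (hM : IsModularSemilattice M) (hfin : ∀ p : M, Order.height p < ⊤)
    {p q u u' : M} {t t' : ℝ} (ht : t < t') (hu : IsOptimal p q t u)
    (hu' : IsOptimal p q t' u') : u' ⊓ p ≤ u ⊓ p ∧ u ⊓ q ≤ u' ⊓ q := by
  obtain ⟨z, hz, z1, z2⟩ := exists_exchange hM hfin hu.1 hu'.1
  obtain ⟨z', hz', z1', z2'⟩ := exists_exchange' hM hfin hu.1 hu'.1
  have o := hu.2 z hz
  have o' := hu'.2 z' hz'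
  have r1 : rank (u ⊓ u' ⊓ p) ≤ rank (u' ⊓ p) :=
    rank_le_rank hfin (inf_le_inf_right p inf_le_right)
  have r2 : rank (u ⊓ u' ⊓ q) ≤ rank (u ⊓ q) :=
    rank_le_rank hfin (inf_le_inf_right q inf_le_left)
  rw [directedRank, directedRank] at o o'
  rw [z2] at o
  rw [z1'] at o'
  have key : rank (u' ⊓ p) ≤ rank (u ⊓ u' ⊓ p) ∧ rank (u ⊓ q) ≤ rank (u ⊓ u' ⊓ q) := by
    rify at *
    have d1 : (rank (z ⊓ p) : ℝ) = rank (u ⊓ p) + rank (u' ⊓ p) - rank (u ⊓ u' ⊓ p) := by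
      linarith
    have d2 : (rank (z' ⊓ q) : ℝ) = rank (u ⊓ q) + rank (u' ⊓ q) - rank (u ⊓ u' ⊓ q) := by
      linarith
    rw [d1] at o
    rw [d2] at o'
    have : (t' - t) * (((rank (u' ⊓ p) : ℝ) - rank (u ⊓ u' ⊓ p)) +
        (rank (u ⊓ q) - rank (u ⊓ u' ⊓ q))) ≤ 0 := by linarith
    have : ((rank (u' ⊓ p) : ℝ) - rank (u ⊓ u' ⊓ p)) +
        (rank (u ⊓ q) - rank (u ⊓ u' ⊓ q)) ≤ 0 := by
      by_contra hlt
      exact absurd (mul_pos (sub_pos.2 ht) (not_le.1 hlt)) (not_lt.2 this)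
    constructor <;> linarith
  rw [inf_comm u u'] at key
  refine ⟨inf_le_of_rank_le hfin key.1, inf_le_of_rank_le hfin ?_⟩
  rw [inf_comm u u']
  exact key.2

/-- Elements with two common optimal directions have the same rank vector. -/
theorem IsOptimal.rankVec_eq {p q u u' : M} {t t' : ℝ} (ht : t < t') (hu : IsOptimal p q t u)
    (hu' : IsOptimal p q t u') (gu : IsOptimal p q t' u) (gu' : IsOptimal p q t' u') :
    rankVec p q u' = rankVec p q u := by
  have h1 := le_antisymm (hu.2 _ hu'.1) (hu'.2 _ hu.1)
  have h2 := le_antisymm (gu.2 _ gu'.1) (gu'.2 _ gu.1)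
  rw [directedRank, directedRank] at h1 h2
  have ht' : t' - t ≠ 0 := (sub_pos.2 ht).ne'
  have e1 : (rank (u' ⊓ p) : ℝ) = rank (u ⊓ p) := by
    apply mul_left_cancel₀ ht'
    linear_combination t' * h1 - t * h2
  have e2 : (rank (u' ⊓ q) : ℝ) = rank (u ⊓ q) := by
    apply mul_left_cancel₀ ht'
    linear_combination (1 - t) * h2 - (1 - t') * h1
  rw [rankVec, rankVec, e1, e2]

end JoinSet

/-! ### Optimality is constant on the cells of a factorial grid. -/

section Grid

/-- An integral affine function does not change sign inside a cell of a grid fine enough. -/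
theorem affine_nonpos_on_cell {A B : ℤ} {R j : ℕ} {m : ℝ} (hR : (A - B).natAbs ≤ R)
    (h1 : (j : ℝ) < m * R.factorial) (h2 : m * R.factorial < j + 1)
    (hm : (1 - m) * A + m * B ≤ 0) :
    (1 - (j : ℝ) / R.factorial) * A + (j : ℝ) / R.factorial * B ≤ 0 ∧
      (1 - ((j + 1 : ℕ) : ℝ) / R.factorial) * A + ((j + 1 : ℕ) : ℝ) / R.factorial * B ≤ 0 := by
  have hN : (0 : ℝ) < R.factorial := by exact_mod_cast R.factorial_pos
  rcases eq_or_ne (A - B) 0 with h0 | h0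
  · have : A = B := by omega
    subst this
    constructor <;> linarith
  have hdvd : (A - B) ∣ (R.factorial : ℤ) := by
    rw [← Int.natAbs_dvd]
    exact_mod_cast Nat.dvd_factorial (Int.natAbs_pos.2 h0) hR
  obtain ⟨k, hk⟩ := hdvd
  have hk' : (R.factorial : ℝ) = ((A : ℝ) - B) * k := by
    have := congrArg (Int.cast : ℤ → ℝ) hk
    push_cast at this
    exact this
  have hD : ((A : ℝ) - B) ≠ 0 := by exact_mod_cast h0
  have hk0 : (k : ℝ) ≠ 0 := by
    rintro h
    rw [h, mul_zero] at hk'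
    exact hN.ne' hk'
  -- The zero lies where `t * R!` equals the integer `k * A`, hence never strictly between `j` and
  -- `j + 1`.
  have g : ∀ t : ℝ, (1 - t) * A + t * B = (k * A - t * R.factorial) / k := by
    intro t
    rw [hk']
    field_simp
    ring
  rw [g] at hm ⊢
  rw [g, div_mul_cancel₀ _ hN.ne', div_mul_cancel₀ _ hN.ne']
  rcases lt_or_gt_of_ne hk0 with hneg | hpos
  · rw [div_nonpos_iff] at hm
    have : 0 ≤ (k : ℝ) * A - m * R.factorial := by
      rcases hm with h | h
      · exact h.1
      · linarith [mul_pos_of_neg_of_neg hneg hneg, h.2]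
    have i : (0 : ℤ) < k * A - j := by
      have : (0 : ℝ) < k * A - j := by linarith
      exact_mod_cast this
    have i' : (j : ℤ) + 1 ≤ k * A := by omega
    have i'' : (j : ℝ) + 1 ≤ k * A := by exact_mod_cast i'
    push_cast
    constructor <;> exact div_nonpos_of_nonneg_of_nonpos (by linarith) hneg.le
  · have : (k : ℝ) * A - m * R.factorial ≤ 0 := by
      by_contra hlt
      exact absurd (div_pos (not_le.1 hlt) hpos) (not_lt.2 hm)
    have i : k * A < (j : ℤ) + 1 := by
      have : (k : ℝ) * A < j + 1 := by linarith
      exact_mod_cast this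
    have i' : k * A ≤ (j : ℤ) := by omega
    have i'' : (k : ℝ) * A ≤ j := by exact_mod_cast i'
    push_cast
    constructor <;> exact div_nonpos_of_nonpos_of_nonneg (by linarith) hpos.le

variable {M : Type*} [SemilatticeInf M]

theorem IsOptimal.of_mem_cell (hfin : ∀ p : M, Order.height p < ⊤) {p q u : M} {m : ℝ} {R j : ℕ}
    (hR : rank p + rank q ≤ R) (hu : IsOptimal p q m u)
    (h1 : (j : ℝ) < m * R.factorial) (h2 : m * R.factorial < j + 1) :
    IsOptimal p q ((j : ℝ) / R.factorial) u ∧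
      IsOptimal p q (((j + 1 : ℕ) : ℝ) / R.factorial) u := by
  have key : ∀ w ∈ joinSet p q, _ := fun w hw => by
    have b1 := rank_le_rank hfin (inf_le_right : u ⊓ p ≤ p)
    have b2 := rank_le_rank hfin (inf_le_right : u ⊓ q ≤ q)
    have b3 := rank_le_rank hfin (inf_le_right : w ⊓ p ≤ p)
    have b4 := rank_le_rank hfin (inf_le_right : w ⊓ q ≤ q)
    have := hu.2 w hw
    rw [directedRank, directedRank] at this
    exact affine_nonpos_on_cell (A := rank (w ⊓ p) - rank (u ⊓ p))
      (B := rank (w ⊓ q) - rank (u ⊓ q)) (m := m) (by omega) h1 h2 (by push_cast; linarith)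
  constructor
  · refine ⟨hu.1, fun w hw => ?_⟩
    have := (key w hw).1
    push_cast at this
    rw [directedRank, directedRank]
    linarith
  · refine ⟨hu.1, fun w hw => ?_⟩
    have := (key w hw).2
    push_cast at this
    rw [directedRank, directedRank]
    push_cast
    linarith

end Grid

/-! ### Telescoping along the chain of optimal elements. -/

section Chain

variable {M : Type*} [SemilatticeInf M]

theorem right_mem_joinSet (p q : M) : q ∈ joinSet p q := by
  rw [joinSet_comm]
  exact left_mem_joinSet q p

theorem IsOptimal.inf_left_eq (hfin : ∀ p : M, Order.height p < ⊤) {p q u : M}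
    (h : IsOptimal p q 0 u) : u ⊓ p = p := by
  refine eq_of_le_of_rank_le hfin inf_le_right ?_
  have := h.2 p (left_mem_joinSet p q)
  simp only [directedRank, sub_zero, one_mul, zero_mul, add_zero, inf_idem] at this
  exact_mod_cast this

theorem IsOptimal.inf_right_eq (hfin : ∀ p : M, Order.height p < ⊤) {p q u : M}
    (h : IsOptimal p q 1 u) : u ⊓ q = q := by
  refine eq_of_le_of_rank_le hfin inf_le_right ?_
  have := h.2 q (right_mem_joinSet p q)
  simp only [directedRank, sub_self, one_mul, zero_mul, zero_add, inf_idem] at this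
  exact_mod_cast this

/-- An element between `u ⊓ q` and `u` is the join of its trace on `p` with `u ⊓ q`. -/
theorem rank_of_mem_Icc (hM : IsModularSemilattice M) (hfin : ∀ p : M, Order.height p < ⊤)
    {p q u c : M} (hu : u ∈ joinSet p q) (h1 : u ⊓ q ≤ c) (h2 : c ≤ u) :
    rank c + rank (p ⊓ q) = rank (c ⊓ p) + rank (u ⊓ q) := by
  obtain ⟨hpq, hl⟩ := mem_joinSet hM hu
  have h := hM.modular h1 hl
  rw [← inf_assoc, inf_eq_left.2 h2] at h
  have e : c ⊓ p ⊓ (u ⊓ q) = p ⊓ q := by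
    refine le_antisymm (inf_le_inf inf_le_right inf_le_right) ?_
    exact le_inf (le_inf ((le_inf hpq inf_le_right).trans h1) inf_le_left)
      (le_inf hpq inf_le_right)
  have := rank_add_rank hM hfin h
  rw [e] at this
  omega

theorem rank_of_mem_Icc' (hM : IsModularSemilattice M) (hfin : ∀ p : M, Order.height p < ⊤)
    {p q u c : M} (hu : u ∈ joinSet p q) (h1 : u ⊓ p ≤ c) (h2 : c ≤ u) :
    rank c + rank (p ⊓ q) = rank (c ⊓ q) + rank (u ⊓ p) := by
  rw [joinSet_comm] at hu
  rw [inf_comm p q]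
  exact rank_of_mem_Icc hM hfin hu h1 h2

variable {f : M → ℝ}

/-- Under the trace inclusions, `u` is the join of `u ⊓ p` and `u ⊓ u'`, and their meet is `u' ⊓ p`.
-/
theorem exchange_step (hM : IsModularSemilattice M)
    (hA : ∀ x y s : M, IsLUB {x, y} s → f (x ⊓ y) + f s ≤ f x + f y)
    {p q u u' : M} (hu : u ∈ joinSet p q)
    (h1 : u' ⊓ p ≤ u ⊓ p) (h2 : u ⊓ q ≤ u' ⊓ q) :
    f (u' ⊓ p) + f u ≤ f (u ⊓ p) + f (u ⊓ u') := by
  have hl := isLUB_pair_iff.1 (mem_joinSet hM hu).2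
  have e : u ⊓ p ⊓ (u ⊓ u') = u' ⊓ p := by
    refine le_antisymm ?_ ?_
    · exact le_inf (inf_le_right.trans inf_le_right) (inf_le_left.trans inf_le_right)
    · exact le_inf h1 (le_inf (h1.trans inf_le_left) inf_le_left)
  have := hA (u ⊓ p) (u ⊓ u') u (isLUB_pair_iff.2 ⟨inf_le_left, inf_le_left, fun c hc hc' =>
    hl.2.2 c hc ((le_inf inf_le_left (h2.trans inf_le_left)).trans hc')⟩)
  rwa [e] at this

/-- Consecutive optimal elements `u`, `u'` satisfy the hypotheses of `hasseDist_inf_le`. -/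
theorem optimal_pair (hM : IsModularSemilattice M) (hfin : ∀ p : M, Order.height p < ⊤)
    {p q u u' : M} {τ : ℝ} (hu : IsOptimal p q τ u) (hu' : IsOptimal p q τ u')
    (h1 : u' ⊓ p ≤ u ⊓ p) (h2 : u ⊓ q ≤ u' ⊓ q) :
    (1 - τ) * ((rank u : ℝ) - rank (u ⊓ u')) = τ * (rank u' - rank (u ⊓ u')) ∧
    ∀ c e, u ⊓ u' ≤ c → c ≤ u → u ⊓ u' ≤ e → e ≤ u' → (∃ b, c ≤ b ∧ e ≤ b) →
      (1 - τ) * ((rank c : ℝ) - rank (u ⊓ u')) + τ * (rank e - rank (u ⊓ u')) ≤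
        (1 - τ) * ((rank u : ℝ) - rank (u ⊓ u')) := by
  have hpq := (mem_joinSet hM hu.1).1
  have hpq' := (mem_joinSet hM hu'.1).1
  have v1 : u ⊓ q ≤ u ⊓ u' := le_inf inf_le_left (h2.trans inf_le_left)
  have v2 : u' ⊓ p ≤ u ⊓ u' := le_inf (h1.trans inf_le_left) inf_le_left
  have ep : u ⊓ u' ⊓ p = u' ⊓ p :=
    le_antisymm (inf_le_inf_right p inf_le_right) (le_inf v2 inf_le_right)
  have eq : u ⊓ u' ⊓ q = u ⊓ q :=
    le_antisymm (inf_le_inf_right q inf_le_left) (le_inf v1 inf_le_right)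
  have rv := rank_of_mem_Icc hM hfin hu.1 v1 inf_le_left
  have ru := rank_of_mem_Icc hM hfin hu.1 inf_le_left le_rfl
  have rv' := rank_of_mem_Icc' hM hfin hu'.1 v2 inf_le_right
  have ru' := rank_of_mem_Icc' hM hfin hu'.1 inf_le_left le_rfl
  rw [ep] at rv
  rw [eq] at rv'
  rify at rv ru rv' ru'
  have du : (rank u : ℝ) - rank (u ⊓ u') = rank (u ⊓ p) - rank (u' ⊓ p) := by linarith
  have du' : (rank u' : ℝ) - rank (u ⊓ u') = rank (u' ⊓ q) - rank (u ⊓ q) := by linarith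
  have ho := le_antisymm (hu.2 _ hu'.1) (hu'.2 _ hu.1)
  rw [directedRank, directedRank] at ho
  refine ⟨by rw [du, du']; linarith, fun c e hc hcu he heu' hb => ?_⟩
  have rc := rank_of_mem_Icc hM hfin hu.1 (v1.trans hc) hcu
  have re := rank_of_mem_Icc' hM hfin hu'.1 (v2.trans he) heu'
  rify at rc re
  have dc : (rank c : ℝ) - rank (u ⊓ u') = rank (c ⊓ p) - rank (u' ⊓ p) := by linarith
  have de : (rank e : ℝ) - rank (u ⊓ u') = rank (e ⊓ q) - rank (u ⊓ q) := by linarith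
  obtain ⟨b, hcb, heb⟩ := hb
  have hv : p ⊓ q ≤ u ⊓ u' := le_inf hpq hpq'
  obtain ⟨w, hw, ew1, ew2⟩ := exists_mem_joinSet hM (p := p) (q := q) (a := c ⊓ p) (b := e ⊓ q)
    (le_inf (hv.trans hc) inf_le_left) inf_le_right (le_inf (hv.trans he) inf_le_right)
    inf_le_right ⟨b, inf_le_left.trans hcb, inf_le_left.trans heb⟩
  have := hu.2 w hw
  rw [directedRank, directedRank, ew1, ew2] at this
  rw [du, dc, de]
  linarith

/-- Combining `exchange_step` with `hB` at `τ = (k + 1) / N` replaces `f (u k ⊓ p) - τ * f (u k)` by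
`f (u (k + 1) ⊓ p) - τ * f (u (k + 1))`, which is no larger. The chain starts at `u 0 ⊓ p = p` and
is closed by `hA` applied to the two traces of the last element. -/
theorem sum_le_of_isOptimal (hM : IsModularSemilattice M) (hfin : ∀ p : M, Order.height p < ⊤)
    (hA : ∀ x y s : M, IsLUB {x, y} s → f (x ⊓ y) + f s ≤ f x + f y)
    (hB : ∀ (x y : M) (τ : ℝ),
      (1 - τ) * ((rank x : ℝ) - rank (x ⊓ y)) = τ * (rank y - rank (x ⊓ y)) →
      (∀ c e, x ⊓ y ≤ c → c ≤ x → x ⊓ y ≤ e → e ≤ y → (∃ b, c ≤ b ∧ e ≤ b) →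
        (1 - τ) * ((rank c : ℝ) - rank (x ⊓ y)) + τ * (rank e - rank (x ⊓ y)) ≤
          (1 - τ) * ((rank x : ℝ) - rank (x ⊓ y))) →
      f (x ⊓ y) ≤ (1 - τ) * f x + τ * f y)
    {p q : M} {N : ℕ} (hN : 0 < N) {u : ℕ → M}
    (hu : ∀ j < N, IsOptimal p q ((j : ℝ) / N) (u j) ∧
      IsOptimal p q (((j + 1 : ℕ) : ℝ) / N) (u j)) :
    f (p ⊓ q) + (∑ j ∈ Finset.range N, f (u j)) / N ≤ f p + f q := by
  have hN' : (0 : ℝ) < N := by exact_mod_cast hN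
  have chain : ∀ k < N, f (u k ⊓ p) + (∑ j ∈ Finset.range k, f (u j)) / N - k / N * f (u k)
      ≤ f p := by
    intro k
    induction k with
    | zero =>
      intro h0
      have := (hu 0 h0).1
      rw [Nat.cast_zero, zero_div] at this
      simp [this.inf_left_eq hfin]
    | succ k ih =>
      intro hk
      have ih := ih (by omega)
      -- Monotonicity of traces needs distinct directions, so the outer ends of the two cells are
      -- used; the shared end serves for `optimal_pair`.
      have hlt : (k : ℝ) / N < ((k + 1 + 1 : ℕ) : ℝ) / N := by
        gcongr
        omega
      obtain ⟨m1, m2⟩ := (hu k (by omega)).1.antitone hM hfin hlt (hu (k + 1) hk).2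
      have s1 := exchange_step hM hA (hu k (by omega)).1.1 m1 m2
      obtain ⟨o1, o2⟩ := optimal_pair hM hfin (hu k (by omega)).2 (hu (k + 1) hk).1 m1 m2
      have s2 := hB _ _ _ o1 o2
      have e : ((k + 1 : ℕ) : ℝ) / N = k / N + 1 / N := by push_cast; ring
      rw [Finset.sum_range_succ, add_div]
      rw [e] at s2 ⊢
      have e' : f (u k) / N = 1 / N * f (u k) := by ring
      rw [e']
      linarith
  obtain ⟨n, rfl⟩ : ∃ n, N = n + 1 := ⟨N - 1, by omega⟩
  have c := chain n (by omega)
  obtain ⟨o1, o2⟩ := hu n (by omega)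
  rw [div_self hN'.ne'] at o2
  have eq := o2.inf_right_eq hfin
  have hl := (mem_joinSet hM o1.1).2
  have ha := hA _ _ _ hl
  rw [eq] at ha
  have em : u n ⊓ p ⊓ q = p ⊓ q := by
    rw [inf_comm (u n), inf_assoc, eq]
  rw [em] at ha
  have e : (n : ℝ) / (n + 1 : ℕ) = 1 - 1 / (n + 1 : ℕ) := by
    push_cast
    field_simp
    ring
  rw [Finset.sum_range_succ, add_div]
  rw [e] at c
  have e' : f (u n) / (n + 1 : ℕ) = 1 / (n + 1 : ℕ) * f (u n) := by ring
  rw [e']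
  linarith

end Chain

/-! ### Cone values as interval lengths, and the passage to submodularity. -/

section Cone

variable {M : Type*} [SemilatticeInf M]

theorem angleValue_mem {α : ℝ} (h0 : 0 ≤ α) (h1 : α ≤ Real.pi / 2) :
    0 < Real.sin α + Real.cos α ∧ 0 ≤ angleValue α ∧ angleValue α ≤ 1 := by
  have hs : 0 ≤ Real.sin α := Real.sin_nonneg_of_nonneg_of_le_pi h0 (by linarith [Real.pi_pos])
  have hc : 0 ≤ Real.cos α :=
    Real.cos_nonneg_of_neg_pi_div_two_le_of_le (by linarith [Real.pi_pos]) h1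
  have hpos : 0 < Real.sin α + Real.cos α := by
    rcases hs.eq_or_lt with h | h
    · rcases hc.eq_or_lt with h' | h'
      · have := Real.sin_sq_add_cos_sq α
        rw [← h, ← h'] at this
        norm_num at this
      · linarith
    · linarith
  refine ⟨hpos, div_nonneg hs hpos.le, ?_⟩
  rw [angleValue, div_le_one hpos]
  linarith

/-- Dividing `(cos α, sin α)` by its positive coordinate sum gives `(1 - t, t)` with `t = angleValue
α`. -/
theorem isOptimal_of_mem_normalCone {p q u : M} (hu : u ∈ joinSet p q) {α : ℝ} (h0 : 0 ≤ α)
    (h1 : α ≤ Real.pi / 2) (h : (Real.cos α, Real.sin α) ∈ normalCone p q u) :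
    IsOptimal p q (angleValue α) u := by
  refine ⟨hu, fun w hw => ?_⟩
  obtain ⟨hpos, -⟩ := angleValue_mem h0 h1
  have := h.2.2 _ (subset_convexHull ℝ _ ⟨w, hw, rfl⟩)
  simp only [rankVec] at this
  have e : ∀ x y : ℝ, (1 - angleValue α) * x + angleValue α * y =
      (Real.cos α * x + Real.sin α * y) / (Real.sin α + Real.cos α) := by
    intro x y
    rw [angleValue]
    field_simp
    ring
  rw [directedRank, directedRank, e, e]
  exact div_le_div_of_nonneg_right (by linarith) hpos.le

theorem exists_isOptimal_of_coneValue_pos {p q u : M} (hu : u ∈ joinSet p q)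
    (h : 0 < coneValue (normalCone p q u)) :
    ∃ s s' : ℝ, 0 ≤ s ∧ s' ≤ 1 ∧ coneValue (normalCone p q u) = s' - s ∧
      IsOptimal p q s u ∧ IsOptimal p q s' u := by
  by_cases hc : ∃ ab, IsAngularCone (normalCone p q u) ab
  · obtain ⟨⟨α, β⟩, hβ, hαβ, hα, e⟩ := hc
    dsimp only at hβ hαβ hα e
    have v := coneValue_angularCone hβ hαβ hα
    rw [← e] at v
    have m1 := (mem_angularCone_iff hβ hα hαβ (hβ.trans hαβ) hα).2 ⟨hαβ, le_rfl⟩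
    have m2 := (mem_angularCone_iff hβ hα hαβ hβ (hαβ.trans hα)).2 ⟨le_rfl, hαβ⟩
    rw [← e] at m1 m2
    exact ⟨angleValue β, angleValue α, (angleValue_mem hβ (hαβ.trans hα)).2.1,
      (angleValue_mem (hβ.trans hαβ) hα).2.2, v,
      isOptimal_of_mem_normalCone hu hβ (hαβ.trans hα) m2,
      isOptimal_of_mem_normalCone hu (hβ.trans hαβ) hα m1⟩
  · rw [coneValue, dif_neg hc] at h
    exact absurd h (lt_irrefl 0)

open Classical in
/-- The value of the cone of an extremal element is at most the proportion of the grid cells on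
which this element is the chosen optimal one. -/
theorem coneValue_le_card_div (hM : IsModularSemilattice M)
    (hfin : ∀ p : M, Order.height p < ⊤) {p q : M} {R : ℕ} (hR : rank p + rank q ≤ R)
    {u : ℕ → M}
    (hu : ∀ j < R.factorial, IsOptimal p q ((j : ℝ) / R.factorial) (u j) ∧
      IsOptimal p q (((j + 1 : ℕ) : ℝ) / R.factorial) (u j))
    {w : M} (hw : w ∈ extremalSet p q) :
    coneValue (normalCone p q w) ≤
      ((Finset.range R.factorial).filter fun j => u j = w).card / (R.factorial : ℝ) := by
  have hN : (0 : ℝ) < R.factorial := by exact_mod_cast R.factorial_pos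
  rcases le_or_gt (coneValue (normalCone p q w)) 0 with h0 | h0
  · exact h0.trans (by positivity)
  obtain ⟨s, s', hs, hs', e, o, o'⟩ := exists_isOptimal_of_coneValue_pos hw.1 h0
  have hss : s < s' := by linarith
  set J := (Finset.range R.factorial).filter fun j => u j = w with hJ
  have cover : Set.Ioo s s' ⊆ ⋃ j ∈ J, Set.Icc ((j : ℝ) / R.factorial)
      (((j + 1 : ℕ) : ℝ) / R.factorial) := by
    rintro m ⟨hm, hm'⟩
    have hm0 : 0 ≤ m := hs.trans hm.le
    set j := ⌊m * R.factorial⌋₊ with hj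
    have j1 : (j : ℝ) ≤ m * R.factorial := Nat.floor_le (by positivity)
    have j2 : m * R.factorial < j + 1 := Nat.lt_floor_add_one _
    have j2' : m < (j + 1) / R.factorial := by rwa [lt_div_iff₀ hN]
    -- `m` may be a grid point; a slightly larger `m'` lies in the open cell and still in the
    -- interval where `w` is optimal.
    obtain ⟨m', hmm, hm'2⟩ := exists_between (lt_min hm' j2')
    obtain ⟨k1, k2⟩ := lt_min_iff.1 hm'2
    rw [lt_div_iff₀ hN] at k2
    have k3 : (j : ℝ) < m' * R.factorial := j1.trans_lt (mul_lt_mul_of_pos_right hmm hN)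
    have hjN : j < R.factorial := by
      have : (j : ℝ) < R.factorial := by
        calc (j : ℝ) < m' * R.factorial := k3
          _ ≤ 1 * R.factorial := by gcongr; linarith
          _ = _ := one_mul _
      exact_mod_cast this
    have om : IsOptimal p q m' w := o.of_mem_Icc o' (hm.trans hmm).le k1.le hss
    obtain ⟨g1, g2⟩ := om.of_mem_cell hfin hR k3 k2
    obtain ⟨g3, g4⟩ := hu j hjN
    have hlt : (j : ℝ) / R.factorial < ((j + 1 : ℕ) : ℝ) / R.factorial := by
      gcongr
      omega
    have := eq_of_rankVec_eq hM hfin hw.1 g3.1 hw.2.prop (g1.rankVec_eq hlt g3 g2 g4)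
    simp only [Set.mem_iUnion]
    refine ⟨j, by simp [hJ, hjN, this], ?_, ?_⟩
    · rwa [div_le_iff₀ hN]
    · push_cast
      exact j2'.le
  have hvol := (MeasureTheory.measure_mono (μ := MeasureTheory.volume) cover).trans
    (MeasureTheory.measure_biUnion_finset_le J _)
  have hlen : ∀ j : ℕ, ((j + 1 : ℕ) : ℝ) / R.factorial - (j : ℝ) / R.factorial =
      1 / R.factorial := by
    intro j
    push_cast
    ring
  simp only [Real.volume_Ioo, Real.volume_Icc, hlen, Finset.sum_const, nsmul_eq_mul] at hvol
  rw [← ENNReal.ofReal_natCast, ← ENNReal.ofReal_mul (Nat.cast_nonneg _),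
    ENNReal.ofReal_le_ofReal_iff (by positivity)] at hvol
  rw [e]
  calc s' - s ≤ J.card * (1 / (R.factorial : ℝ)) := hvol
    _ = J.card / (R.factorial : ℝ) := by ring

open Classical in
theorem isSubmodular_of_local (hM : IsModularSemilattice M)
    (hfin : ∀ p : M, Order.height p < ⊤) {f : M → ℝ} (hf : ∀ x, 0 ≤ f x)
    (hA : ∀ x y s : M, IsLUB {x, y} s → f (x ⊓ y) + f s ≤ f x + f y)
    (hB : ∀ (x y : M) (τ : ℝ),
      (1 - τ) * ((rank x : ℝ) - rank (x ⊓ y)) = τ * (rank y - rank (x ⊓ y)) →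
      (∀ c e, x ⊓ y ≤ c → c ≤ x → x ⊓ y ≤ e → e ≤ y → (∃ b, c ≤ b ∧ e ≤ b) →
        (1 - τ) * ((rank c : ℝ) - rank (x ⊓ y)) + τ * (rank e - rank (x ⊓ y)) ≤
          (1 - τ) * ((rank x : ℝ) - rank (x ⊓ y))) →
      f (x ⊓ y) ≤ (1 - τ) * f x + τ * f y) :
    IsSubmodular f := by
  intro p q
  set R := rank p + rank q with hR
  have hN : (0 : ℝ) < R.factorial := by exact_mod_cast R.factorial_pos
  -- An optimal element at the midpoint of a cell is optimal at both of its ends.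
  choose u hu using fun j : ℕ => exists_isOptimal hfin p q (((j : ℝ) + 1 / 2) / R.factorial)
  have hu' : ∀ j < R.factorial, IsOptimal p q ((j : ℝ) / R.factorial) (u j) ∧
      IsOptimal p q (((j + 1 : ℕ) : ℝ) / R.factorial) (u j) := fun j _ =>
    (hu j).of_mem_cell hfin hR.ge (by rw [div_mul_cancel₀ _ hN.ne']; linarith)
      (by rw [div_mul_cancel₀ _ hN.ne']; linarith)
  have key := sum_le_of_isOptimal hM hfin hA hB R.factorial_pos hu'
  refine le_trans ?_ key
  gcongr
  have hE := finite_extremalSet hM hfin p q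
  rw [finsum_mem_eq_finite_toFinset_sum _ hE]
  calc ∑ w ∈ hE.toFinset, coneValue (normalCone p q w) * f w
      ≤ ∑ w ∈ hE.toFinset,
        (∑ j ∈ (Finset.range R.factorial).filter fun j => u j = w, f (u j)) / R.factorial := by
        refine Finset.sum_le_sum fun w hw => ?_
        have h := mul_le_mul_of_nonneg_right
          (coneValue_le_card_div hM hfin hR.ge hu' (hE.mem_toFinset.1 hw)) (hf w)
        refine h.trans_eq ?_
        rw [Finset.sum_congr rfl (g := fun _ => f w)
          fun j hj => by rw [(Finset.mem_filter.1 hj).2], Finset.sum_const, nsmul_eq_mul]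
        ring
    _ ≤ (∑ j ∈ Finset.range R.factorial, f (u j)) / R.factorial := by
        rw [← Finset.sum_div]
        gcongr
        rw [← Finset.sum_biUnion]
        -- Cells whose chosen element is not extremal are dropped, at no loss since `f ≥ 0`.
        · refine Finset.sum_le_sum_of_subset_of_nonneg ?_ fun j _ _ => hf _
          intro j hj
          obtain ⟨w, -, hj⟩ := Finset.mem_biUnion.1 hj
          exact (Finset.mem_filter.1 hj).1
        · intro w _ w' _ hne
          refine Finset.disjoint_left.2 fun j hj hj' => hne ?_
          rw [← (Finset.mem_filter.1 hj).2, (Finset.mem_filter.1 hj').2]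

end Cone

end FracJoin

theorem mainTheorem7 {L : Type*} [SemilatticeInf L] [OrderBot L]
    (hL : FracJoin.IsModularSemilattice L) (hfin : ∀ p : L, Order.height p < ⊤) :
    (∀ x y : L × L, (FracJoin.extremalSet x y).Finite) ∧
    (∀ p q : L, (SimpleGraph.hasse L).Reachable p q ∧
      FracJoin.hasseDist (p, q) =
        (FracJoin.rank p : ℝ) + FracJoin.rank q - 2 * FracJoin.rank (p ⊓ q)) ∧
    FracJoin.IsSubmodular (FracJoin.hasseDist (L := L)) := by
  have hM := hL.prod hL
  have hfin' := FracJoin.height_prod_lt_top hfin hfin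
  exact ⟨FracJoin.finite_extremalSet hM hfin', FracJoin.hasse_reachable_and_dist hL hfin,
    FracJoin.isSubmodular_of_local hM hfin' (fun x => Nat.cast_nonneg _)
      (fun _ _ _ => FracJoin.hasseDist_inf_add_sup_le hL hfin)
      (fun _ _ _ => FracJoin.hasseDist_inf_le hL hfin)⟩
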